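/- Let $n,m\in\mathbb{N}$, $B_{g1}\in\mathbb{R}^{n\times m}$, let $Q\in\mathbb{R}^{n\times n}$ be symmetric positive semidefinite and $R\in\mathbb{R}^{m\times m}$ symmetric positive definite, and assume that the pair $(I,B_{g1})$ is controllable. Consider the discrete algebraic Riccati equation (DARE) $$P=Q+P(I-B_{g1}K_1),\qquad K_1=(R+B_{g1}^\top P B_{g1})^{-1}B_{g1}^\top P .$$ It has exactly one symmetric positive semidefinite solution $P$. The matrix $I-B_{g1}K_1$ has all its eigenvalues in the open unit disc if and only if $Q$ is positive definite, and likewise $I-(I-B_{g1}K_1)^\top$ is invertible if and only if $Q$ is positive definite. If $Q$ is positive definite, put $$K_{e1}=(R+B_{g1}^\top P B_{g1})^{-1}B_{g1}^\top\bigl(I-(I-B_{g1}K_1)^\top\bigr)^{-1}P .$$ For every $C\in\mathbb{R}$, $\bar e_1\in\mathbb{R}^n$ and initial state $x(0)=x_0\in\mathbb{R}^n$, consider the system $$x(k+1)=x(k)+B_{g1}g(k)+C\bar e_1\qquad(k\ge 0)$$ with the infinite-horizon cost $J_\infty(g)=\tfrac12\sum_{k=0}^{\infty}\bigl(x(k)^\top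 Qx(k)+g(k)^\top Rg(k)\bigr)\in[0,\infty]$. Then the input given by $$g(k)=-K_1x(k)-K_{e1}C\bar e_1\qquad(k\ge 0)$$ is the optimal one, in each of the following senses. 1. It is the unique overtaking optimal input: writing $J_N$ for the sum of the first $N$ terms of $J_\infty$, an input $v$ satisfies $\limsup_{N\to\infty}(J_N(v)-J_N(w))\le 0$ for all inputs $w$ if and only if $v=g$. 2. $J_\infty(g)\le J_\infty(v)$ for every input $v$. 3. It is the limit of the finite-horizon optimal inputs: for every symmetric positive semidefinite terminal weight $S$, the cost $\tfrac12x(N)^\top Sx(N)+J_N$ has a minimizer for every $N$, and for any choice of minimizers $w^N$ one has $w^N(k)\to g(k)$ as $N\to\infty$ for each $k$. -/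

import Mathlib

open Matrix Filter Topology

namespace LQ

/-- The state trajectory of `x (k+1) = A x k + B u k + e` with `x 0 = x₀` under the input `u`. -/
def state {n m : ℕ} (A : Matrix (Fin n) (Fin n) ℝ) (B : Matrix (Fin n) (Fin m) ℝ)
    (e x₀ : Fin n → ℝ) (u : ℕ → Fin m → ℝ) : ℕ → Fin n → ℝ
  | 0 => x₀
  | k + 1 => A *ᵥ state A B e x₀ u k + B *ᵥ u k + e

/-- Controllability of the pair `(A, B)`: the disturbance-free system can be steered from any state
to any other state in finitely many steps. -/
def IsControllable {n m : ℕ} (A : Matrix (Fin n) (Fin n) ℝ) (B : Matrix (Fin n) (Fin m) ℝ) : Prop :=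
  ∀ x₀ x₁ : Fin n → ℝ, ∃ (u : ℕ → Fin m → ℝ) (N : ℕ), state A B 0 x₀ u N = x₁

/-- The stage cost `(xᵀ Q x + uᵀ R u) / 2`. -/
noncomputable def stageCost {n m : ℕ} (Q : Matrix (Fin n) (Fin n) ℝ) (R : Matrix (Fin m) (Fin m) ℝ)
    (x : Fin n → ℝ) (u : Fin m → ℝ) : ℝ :=
  (1 / 2 : ℝ) * (x ⬝ᵥ (Q *ᵥ x) + u ⬝ᵥ (R *ᵥ u))

/-- The finite-horizon cost
`x_Nᵀ S x_N / 2 + ∑_{k < N} (x_kᵀ Q x_k + u_kᵀ R u_k) / 2`, with terminal weight `S`. -/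
noncomputable def finiteCost {n m : ℕ} (A : Matrix (Fin n) (Fin n) ℝ)
    (B : Matrix (Fin n) (Fin m) ℝ) (Q : Matrix (Fin n) (Fin n) ℝ) (R : Matrix (Fin m) (Fin m) ℝ)
    (e x₀ : Fin n → ℝ) (S : Matrix (Fin n) (Fin n) ℝ) (N : ℕ) (u : ℕ → Fin m → ℝ) : ℝ :=
  (1 / 2 : ℝ) * (state A B e x₀ u N ⬝ᵥ (S *ᵥ state A B e x₀ u N)) +
    ∑ k ∈ Finset.range N, stageCost Q R (state A B e x₀ u k) (u k)

/-- The infinite-horizon cost `∑_{k ≥ 0} (x_kᵀ Q x_k + u_kᵀ R u_k) / 2`, with values in `[0, ∞]`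
(for positive semidefinite weights every summand is nonnegative). -/
noncomputable def infiniteCost {n m : ℕ} (A : Matrix (Fin n) (Fin n) ℝ)
    (B : Matrix (Fin n) (Fin m) ℝ) (Q : Matrix (Fin n) (Fin n) ℝ) (R : Matrix (Fin m) (Fin m) ℝ)
    (e x₀ : Fin n → ℝ) (u : ℕ → Fin m → ℝ) : ENNReal :=
  ∑' k, ENNReal.ofReal (stageCost Q R (state A B e x₀ u k) (u k))

/-- `u` minimizes the horizon-`N` cost with terminal weight `S`. -/
def IsFiniteOptimal {n m : ℕ} (A : Matrix (Fin n) (Fin n) ℝ)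
    (B : Matrix (Fin n) (Fin m) ℝ) (Q : Matrix (Fin n) (Fin n) ℝ) (R : Matrix (Fin m) (Fin m) ℝ)
    (e x₀ : Fin n → ℝ) (S : Matrix (Fin n) (Fin n) ℝ) (N : ℕ) (u : ℕ → Fin m → ℝ) : Prop :=
  ∀ v : ℕ → Fin m → ℝ, finiteCost A B Q R e x₀ S N u ≤ finiteCost A B Q R e x₀ S N v

/-- Overtaking optimality on the infinite horizon: with `J_N` the sum of the first `N` stage costs,
`limsup_{N → ∞} (J_N u - J_N v) ≤ 0` for every competing input `v`. When the infinite sum of `u` is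
finite this is minimality of the sum; it stays meaningful when every input has infinite cost. -/
def IsOvertakingOptimal {n m : ℕ} (A : Matrix (Fin n) (Fin n) ℝ)
    (B : Matrix (Fin n) (Fin m) ℝ) (Q : Matrix (Fin n) (Fin n) ℝ) (R : Matrix (Fin m) (Fin m) ℝ)
    (e x₀ : Fin n → ℝ) (u : ℕ → Fin m → ℝ) : Prop :=
  ∀ v : ℕ → Fin m → ℝ, ∀ ε : ℝ, 0 < ε → ∀ᶠ N in atTop,
    finiteCost A B Q R e x₀ 0 N u ≤ finiteCost A B Q R e x₀ 0 N v + ε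

/-- The feedback gain `K = (R + Bᵀ P B)⁻¹ Bᵀ P A`. -/
noncomputable def fbGain {n m : ℕ} (A : Matrix (Fin n) (Fin n) ℝ) (B : Matrix (Fin n) (Fin m) ℝ)
    (R : Matrix (Fin m) (Fin m) ℝ) (P : Matrix (Fin n) (Fin n) ℝ) : Matrix (Fin m) (Fin n) ℝ :=
  (R + Bᵀ * P * B)⁻¹ * Bᵀ * P * A

/-- The discrete algebraic Riccati equation `P = Q + Aᵀ P (A - B K)`. -/
def SolvesDARE {n m : ℕ} (A : Matrix (Fin n) (Fin n) ℝ) (B : Matrix (Fin n) (Fin m) ℝ)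
    (Q : Matrix (Fin n) (Fin n) ℝ) (R : Matrix (Fin m) (Fin m) ℝ)
    (P : Matrix (Fin n) (Fin n) ℝ) : Prop :=
  P = Q + Aᵀ * P * (A - B * fbGain A B R P)

/-- The feedforward gain `Kᵉ = (R + Bᵀ P B)⁻¹ Bᵀ (I - (A - B K)ᵀ)⁻¹ P`. -/
noncomputable def ffGain {n m : ℕ} (A : Matrix (Fin n) (Fin n) ℝ) (B : Matrix (Fin n) (Fin m) ℝ)
    (R : Matrix (Fin m) (Fin m) ℝ) (P : Matrix (Fin n) (Fin n) ℝ) : Matrix (Fin m) (Fin n) ℝ :=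
  (R + Bᵀ * P * B)⁻¹ * Bᵀ * (1 - (A - B * fbGain A B R P)ᵀ)⁻¹ * P

/-- Discrete-time stability: all complex eigenvalues lie in the open unit disc. -/
def IsStable {n : ℕ} (F : Matrix (Fin n) (Fin n) ℝ) : Prop :=
  ∀ z ∈ spectrum ℂ (F.map (algebraMap ℝ ℂ)), ‖z‖ < 1

end LQ

/-!
With state matrix `1`, controllability of `(1, B)` means that `B` is right invertible, and
`M = B R⁻¹ Bᵀ` is positive definite.

**Riccati equation.** The closed-loop matrix is `1 - B K = (1 + M P)⁻¹`, and clearing this inverse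
turns the Riccati equation into `P M P = Q + Q M P`
(`solvesDARE_one_iff_quadratic`). For symmetric `P` this implies
`(2 P - Q) M (2 P - Q) = 4 Q + Q M Q`. Conjugated by the square root of `M`, the matrix `2 P - Q` is
thus a positive semidefinite square root of a matrix determined by `Q`, which gives uniqueness, and
reading the formula backwards gives existence. Since `P B K = Q`, the matrix `B K`
is invertible if `Q` is, while a kernel vector of `Q` is fixed by `1 - B K`.

**Removing the disturbance.** The feedforward input `κ = Kᵉ e` equals `R⁻¹ Bᵀ M⁻¹ e`; it satisfies
`B κ = e` and `R κ = Bᵀ l` with `l = M⁻¹ e`. In terms of the shifted input `w = u + κ` the system is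
undisturbed, and the cross terms `κᵀ R w = lᵀ B w` telescope. The cost becomes the undisturbed cost
minus `lᵀ x(N)`, up to a quantity independent of the input (`finiteCost_eq_tiltedCost`).

**Overtaking optimality.** Completing the square with `P` writes the undisturbed cost as boundary
terms plus the accumulated squared deviation from the feedback law `w = -K x`
(`IsRegulator.runCost_eq`). An input of bounded cost drives the state to the origin, so the terminal
terms vanish in the limit. If the cost is unbounded, the last stage dominates the linear term
`lᵀ x(N)`. Optimality for the infinite sum follows by passing to the limit of partial sums.

**Finite-horizon limit.** The running costs of the minimizers are bounded uniformly in the horizon,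
so they visit a state close to the origin in the second half of the horizon
(`IsRegulator.exists_turnpike`). As `B` is right invertible, the feedback trajectory can be steered
onto that state in one step at small cost; comparison with this competitor forces the deviations of
the minimizers from the feedback law to tend to zero (`IsRegulator.tendsto_deviation`).
-/

namespace LQ

/-! ### Algebra of the Riccati equation -/

section Riccati

variable {n m : ℕ} {B : Matrix (Fin n) (Fin m) ℝ} {P Q : Matrix (Fin n) (Fin n) ℝ}
  {R : Matrix (Fin m) (Fin m) ℝ}

theorem transpose_eq_of_isHermitian {k : ℕ} {M : Matrix (Fin k) (Fin k) ℝ} (h : M.IsHermitian) :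
    Mᵀ = M := by
  rw [← conjTranspose_eq_transpose_of_trivial]
  exact h

theorem dotProduct_mulVec_swap {k l : ℕ} (M : Matrix (Fin k) (Fin l) ℝ) (x : Fin k → ℝ)
    (y : Fin l → ℝ) : x ⬝ᵥ (M *ᵥ y) = y ⬝ᵥ (Mᵀ *ᵥ x) := by
  rw [mulVec_transpose, dotProduct_mulVec, dotProduct_comm]

/-- With `A = 1` every state reachable from the origin lies in the range of `B`, so controllability
forces `B` to be right invertible. -/
theorem IsControllable.exists_mul_eq_one (h : IsControllable 1 B) :
    ∃ E : Matrix (Fin m) (Fin n) ℝ, B * E = 1 := by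
  rw [← mulVec_surjective_iff_exists_right_inverse]
  intro y
  have key : ∀ (u : ℕ → Fin m → ℝ) (N : ℕ), ∃ z, B *ᵥ z = state 1 B 0 0 u N := by
    intro u N
    induction N with
    | zero => exact ⟨0, by simp [state]⟩
    | succ k ih =>
      obtain ⟨z, hz⟩ := ih
      exact ⟨z + u k, by simp [state, mulVec_add, hz]⟩
  obtain ⟨u, N, hu⟩ := h 0 y
  obtain ⟨z, hz⟩ := key u N
  exact ⟨z, hz.trans hu⟩

theorem posDef_mul_inv_mul_transpose (hR : R.PosDef) {E : Matrix (Fin m) (Fin n) ℝ}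
    (hE : B * E = 1) : (B * R⁻¹ * Bᵀ).PosDef := by
  have := hR.inv.mul_mul_conjTranspose_same (B := B) (fun x y hxy => by
    have := congrArg (fun z => z ᵥ* E) hxy
    simpa [vecMul_vecMul, hE] using this)
  simpa using this

theorem posDef_add_transpose_mul_mul (hR : R.PosDef) (hP : P.PosSemidef) :
    (R + Bᵀ * P * B).PosDef := by
  have := hP.conjTranspose_mul_mul_same B
  rw [conjTranspose_eq_transpose_of_trivial] at this
  exact hR.add_posSemidef this

theorem solvesDARE_one_iff :
    SolvesDARE 1 B Q R P ↔ P * B * fbGain 1 B R P = Q := by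
  unfold SolvesDARE
  rw [transpose_one, Matrix.one_mul, Matrix.mul_sub, Matrix.mul_one, ← Matrix.mul_assoc]
  constructor <;> intro h
  · rw [eq_comm, ← sub_eq_zero] at h
    rw [eq_comm, ← sub_eq_zero]
    rw [← h]; abel
  · rw [h]; abel

/-- The push-through identity `(R + Bᵀ P B)⁻¹ Bᵀ (1 + P B R⁻¹ Bᵀ) = R⁻¹ Bᵀ`. -/
theorem inv_mul_transpose_mul_one_add (hR : R.PosDef) (hP : P.PosSemidef) :
    (R + Bᵀ * P * B)⁻¹ * Bᵀ * (1 + P * (B * R⁻¹ * Bᵀ)) = R⁻¹ * Bᵀ := by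
  have h1 : IsUnit R.det := (isUnit_iff_isUnit_det _).1 hR.isUnit
  have h2 : IsUnit (R + Bᵀ * P * B).det :=
    (isUnit_iff_isUnit_det _).1 (posDef_add_transpose_mul_mul hR hP).isUnit
  have h3 : Bᵀ * (1 + P * (B * R⁻¹ * Bᵀ)) = (R + Bᵀ * P * B) * (R⁻¹ * Bᵀ) := by
    rw [Matrix.add_mul, ← Matrix.mul_assoc R, mul_nonsing_inv _ h1]
    simp only [Matrix.mul_add, Matrix.mul_one, Matrix.one_mul, Matrix.mul_assoc]
  rw [Matrix.mul_assoc, h3, ← Matrix.mul_assoc, nonsing_inv_mul _ h2, Matrix.one_mul]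

theorem mul_fbGain_mul_one_add (hR : R.PosDef) (hP : P.PosSemidef) :
    B * fbGain 1 B R P * (1 + B * R⁻¹ * Bᵀ * P) = B * R⁻¹ * Bᵀ * P := by
  calc B * fbGain 1 B R P * (1 + B * R⁻¹ * Bᵀ * P)
      = B * ((R + Bᵀ * P * B)⁻¹ * Bᵀ * (1 + P * (B * R⁻¹ * Bᵀ))) * P := by
        simp only [fbGain, Matrix.mul_add, Matrix.add_mul, Matrix.mul_one, Matrix.mul_assoc]
    _ = _ := by rw [inv_mul_transpose_mul_one_add hR hP]; simp only [Matrix.mul_assoc]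

/-- The closed-loop matrix is the inverse of `1 + B R⁻¹ Bᵀ P`. -/
theorem closedLoop_mul_one_add (hR : R.PosDef) (hP : P.PosSemidef) :
    (1 - B * fbGain 1 B R P) * (1 + B * R⁻¹ * Bᵀ * P) = 1 := by
  rw [Matrix.sub_mul, mul_fbGain_mul_one_add hR hP, Matrix.one_mul]; abel

/-- Clearing the inverse from the Riccati equation leaves a quadratic matrix equation. -/
theorem solvesDARE_one_iff_quadratic (hR : R.PosDef) (hP : P.PosSemidef) :
    SolvesDARE 1 B Q R P ↔ P * (B * R⁻¹ * Bᵀ) * P = Q + Q * (B * R⁻¹ * Bᵀ) * P := by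
  have h1 : P * B * fbGain 1 B R P * (1 + B * R⁻¹ * Bᵀ * P) = P * (B * R⁻¹ * Bᵀ) * P := by
    rw [Matrix.mul_assoc P B, Matrix.mul_assoc P, mul_fbGain_mul_one_add hR hP,
      Matrix.mul_assoc P]
  have h2 := mul_eq_one_comm.1 (closedLoop_mul_one_add (B := B) hR hP)
  have h3 : Q * (1 + B * R⁻¹ * Bᵀ * P) = Q + Q * (B * R⁻¹ * Bᵀ) * P := by
    rw [Matrix.mul_add, Matrix.mul_one, ← Matrix.mul_assoc]
  rw [solvesDARE_one_iff]
  constructor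
  · intro h
    rw [← h1, h, h3]
  · intro h
    rw [← h3, ← h1] at h
    have := congrArg (· * (1 - B * fbGain 1 B R P)) h
    rwa [Matrix.mul_assoc, h2, Matrix.mul_one, Matrix.mul_assoc Q, h2, Matrix.mul_one] at this

theorem mul_fbGain_eq (hR : R.PosDef) (hP : P.PosSemidef) :
    (R + Bᵀ * P * B) * fbGain 1 B R P = Bᵀ * P := by
  have h2 : IsUnit (R + Bᵀ * P * B).det :=
    (isUnit_iff_isUnit_det _).1 (posDef_add_transpose_mul_mul hR hP).isUnit
  rw [fbGain, Matrix.mul_one, ← Matrix.mul_assoc, ← Matrix.mul_assoc, mul_nonsing_inv _ h2,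
    Matrix.one_mul]

/-- Completion of the square for one step of the undisturbed system. -/
theorem SolvesDARE.complete_square (hR : R.PosDef) (hP : P.PosSemidef)
    (h : SolvesDARE 1 B Q R P) (x : Fin n → ℝ) (w : Fin m → ℝ) :
    x ⬝ᵥ (Q *ᵥ x) + w ⬝ᵥ (R *ᵥ w) =
      x ⬝ᵥ (P *ᵥ x) - (x + B *ᵥ w) ⬝ᵥ (P *ᵥ (x + B *ᵥ w)) +
        (w + fbGain 1 B R P *ᵥ x) ⬝ᵥ ((R + Bᵀ * P * B) *ᵥ (w + fbGain 1 B R P *ᵥ x)) := by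
  have hPt : Pᵀ = P := transpose_eq_of_isHermitian hP.isHermitian
  have hK := mul_fbGain_eq (B := B) hR hP
  rw [solvesDARE_one_iff] at h
  set K := fbGain 1 B R P
  set H := R + Bᵀ * P * B with hH
  have hHt : Hᵀ = H :=
    transpose_eq_of_isHermitian (posDef_add_transpose_mul_mul (B := B) hR hP).isHermitian
  have e1 : (B *ᵥ w) ⬝ᵥ (P *ᵥ x) = w ⬝ᵥ ((Bᵀ * P) *ᵥ x) := by
    rw [dotProduct_comm, dotProduct_mulVec_swap, mulVec_mulVec]
  have e2 : x ⬝ᵥ (P *ᵥ (B *ᵥ w)) = w ⬝ᵥ ((Bᵀ * P) *ᵥ x) := by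
    rw [mulVec_mulVec, dotProduct_mulVec_swap, transpose_mul, hPt]
  have e3 : (B *ᵥ w) ⬝ᵥ (P *ᵥ (B *ᵥ w)) = w ⬝ᵥ ((Bᵀ * P * B) *ᵥ w) := by
    rw [dotProduct_comm, dotProduct_mulVec_swap, mulVec_mulVec, mulVec_mulVec, Matrix.mul_assoc]
  have e4 : w ⬝ᵥ (H *ᵥ (K *ᵥ x)) = w ⬝ᵥ ((Bᵀ * P) *ᵥ x) := by rw [mulVec_mulVec, hK]
  have e5 : (K *ᵥ x) ⬝ᵥ (H *ᵥ w) = w ⬝ᵥ ((Bᵀ * P) *ᵥ x) := by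
    rw [dotProduct_mulVec_swap, hHt, e4]
  have e6 : (K *ᵥ x) ⬝ᵥ (H *ᵥ (K *ᵥ x)) = x ⬝ᵥ (Q *ᵥ x) := by
    rw [mulVec_mulVec, hK, dotProduct_mulVec_swap, transpose_mul, hPt, transpose_transpose,
      mulVec_mulVec, h]
  have e7 : w ⬝ᵥ (H *ᵥ w) = w ⬝ᵥ (R *ᵥ w) + w ⬝ᵥ ((Bᵀ * P * B) *ᵥ w) := by
    rw [hH, add_mulVec, dotProduct_add]
  simp only [mulVec_add, dotProduct_add, add_dotProduct, e1, e2, e3, e4, e5, e6, e7]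
  ring

/-- Completing the square with `w = -K x` shows `xᵀ (P - Q) x ≥ 0`. -/
theorem SolvesDARE.posSemidef_sub (hR : R.PosDef) (hP : P.PosSemidef) (hQ : Q.PosSemidef)
    (h : SolvesDARE 1 B Q R P) : (P - Q).PosSemidef := by
  refine PosSemidef.of_dotProduct_mulVec_nonneg (hP.isHermitian.sub hQ.isHermitian) fun x => ?_
  have h1 := h.complete_square hR hP x (-(fbGain 1 B R P *ᵥ x))
  have h2 := hP.dotProduct_mulVec_nonneg (x + B *ᵥ (-(fbGain 1 B R P *ᵥ x)))
  have h3 := hR.posSemidef.dotProduct_mulVec_nonneg (-(fbGain 1 B R P *ᵥ x))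
  simp only [star_trivial, neg_add_cancel, zero_dotProduct] at h1 h2 h3 ⊢
  rw [sub_mulVec, dotProduct_sub]
  linarith

open scoped MatrixOrder in
/-- Conjugated by the square root `W` of `M`, the matrix `X M X` becomes the square of the positive
semidefinite matrix `W X W`, which is therefore determined by it. -/
theorem eq_of_mul_mul_eq {M X Y : Matrix (Fin n) (Fin n) ℝ} (hM : M.PosDef) (hX : X.PosSemidef)
    (hY : Y.PosSemidef) (h : X * M * X = Y * M * Y) : X = Y := by
  set W := CFC.sqrt M with hW
  have hM0 : 0 ≤ M := nonneg_iff_posSemidef.2 hM.posSemidef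
  have hWW : W * W = M := CFC.sqrt_mul_sqrt_self M hM0
  have hWp : W.PosSemidef := nonneg_iff_posSemidef.1 (CFC.sqrt_nonneg M)
  have hWt : Wᴴ = W := hWp.isHermitian
  have hWu : IsUnit W := by
    have := hM.isUnit
    rw [← hWW, isUnit_iff_isUnit_det, det_mul] at this
    exact (isUnit_iff_isUnit_det _).2 (isUnit_of_mul_isUnit_left this)
  have hsq : ∀ Z : Matrix (Fin n) (Fin n) ℝ, Z.PosSemidef →
      CFC.sqrt (W * (Z * M * Z) * W) = W * Z * W := by
    intro Z hZ
    refine CFC.sqrt_unique ?_ ?_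
    · rw [← hWW]; simp only [Matrix.mul_assoc]
    · have := hZ.mul_mul_conjTranspose_same W
      rw [hWt] at this
      exact nonneg_iff_posSemidef.2 this
  have h1 : W * X * W = W * Y * W := by rw [← hsq X hX, ← hsq Y hY, h]
  exact hWu.mul_left_cancel (hWu.mul_right_cancel h1)

/-- Every solution satisfies `(2 P - Q) M (2 P - Q) = 4 Q + Q M Q` with `M = B R⁻¹ Bᵀ` and
`2 P - Q` positive semidefinite. -/
theorem SolvesDARE.unique {E : Matrix (Fin m) (Fin n) ℝ} (hE : B * E = 1) (hR : R.PosDef)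
    (hQ : Q.PosSemidef) {P' : Matrix (Fin n) (Fin n) ℝ} (hP : P.PosSemidef)
    (hP' : P'.PosSemidef) (h : SolvesDARE 1 B Q R P) (h' : SolvesDARE 1 B Q R P') : P' = P := by
  have hM := posDef_mul_inv_mul_transpose hR hE
  have hQt : Qᵀ = Q := transpose_eq_of_isHermitian hQ.isHermitian
  have hMt : (B * R⁻¹ * Bᵀ)ᵀ = B * R⁻¹ * Bᵀ := transpose_eq_of_isHermitian hM.isHermitian
  have key : ∀ Z : Matrix (Fin n) (Fin n) ℝ, Z.PosSemidef → SolvesDARE 1 B Q R Z →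
      (Z + (Z - Q)).PosSemidef ∧ (Z + (Z - Q)) * (B * R⁻¹ * Bᵀ) * (Z + (Z - Q)) =
        (4 : ℝ) • Q + Q * (B * R⁻¹ * Bᵀ) * Q := by
    intro Z hZ hs
    refine ⟨hZ.add (hs.posSemidef_sub hR hZ hQ), ?_⟩
    have hZt : Zᵀ = Z := transpose_eq_of_isHermitian hZ.isHermitian
    have e1 := (solvesDARE_one_iff_quadratic hR hZ).1 hs
    have e2 := congrArg transpose e1
    set M := B * R⁻¹ * Bᵀ
    simp only [transpose_mul, transpose_add, hZt, hQt, hMt, ← Matrix.mul_assoc] at e2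
    have : (Z + (Z - Q)) * M * (Z + (Z - Q)) =
        (2 : ℝ) • (Z * M * Z) + (2 : ℝ) • (Z * M * Z) - (2 : ℝ) • (Q * M * Z)
          - (2 : ℝ) • (Z * M * Q) + Q * M * Q := by
      simp only [Matrix.add_mul, Matrix.sub_mul, Matrix.mul_add, Matrix.mul_sub, two_smul]
      abel
    rw [this]
    nth_rewrite 1 [e1]
    rw [e2]
    module
  obtain ⟨p1, p2⟩ := key P hP h
  obtain ⟨p1', p2'⟩ := key P' hP' h'
  have e := eq_of_mul_mul_eq hM p1' p1 (p2'.trans p2.symm)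
  have e' : (2 : ℝ) • P' = (2 : ℝ) • P := by
    have := congrArg (· + Q) e
    rw [two_smul, two_smul]
    calc P' + P' = P' + (P' - Q) + Q := by abel
      _ = P + (P - Q) + Q := this
      _ = P + P := by abel
  exact smul_right_injective _ (two_ne_zero (α := ℝ)) e'

open scoped MatrixOrder in
/-- Conjugating by the square root `W` of `M = B R⁻¹ Bᵀ` and writing `T = W Q W`, the solution is
`W⁻¹ (T + √(4 T + T²)) W⁻¹ / 2`. -/
theorem exists_solvesDARE {E : Matrix (Fin m) (Fin n) ℝ} (hE : B * E = 1) (hR : R.PosDef)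
    (hQ : Q.PosSemidef) : ∃ P, P.PosSemidef ∧ SolvesDARE 1 B Q R P := by
  have hM := posDef_mul_inv_mul_transpose hR hE
  set M := B * R⁻¹ * Bᵀ with hMdef
  set W := CFC.sqrt M with hW
  have hM0 : 0 ≤ M := nonneg_iff_posSemidef.2 hM.posSemidef
  have hWW : W * W = M := CFC.sqrt_mul_sqrt_self M hM0
  have hWp : W.PosSemidef := nonneg_iff_posSemidef.1 (CFC.sqrt_nonneg M)
  have hWt : Wᴴ = W := hWp.isHermitian
  have hWu : IsUnit W.det := by
    have := hM.isUnit
    rw [← hWW, isUnit_iff_isUnit_det, det_mul] at this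
    exact isUnit_of_mul_isUnit_left this
  set T := W * Q * W with hT
  have hTp : T.PosSemidef := by
    have := hQ.mul_mul_conjTranspose_same W
    rwa [hWt] at this
  have hTTp : ((4 : ℝ) • T + T * T).PosSemidef := by
    refine (hTp.smul (by norm_num)).add ?_
    rw [← sq]; exact hTp.pow 2
  set Z := CFC.sqrt ((4 : ℝ) • T + T * T) with hZ
  have hZZ : Z * Z = (4 : ℝ) • T + T * T :=
    CFC.sqrt_mul_sqrt_self _ (nonneg_iff_posSemidef.2 hTTp)
  have hZp : Z.PosSemidef := nonneg_iff_posSemidef.1 (CFC.sqrt_nonneg _)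
  have hcomm : Z * T = T * Z := by
    have : Commute ((4 : ℝ) • T + T * T) T :=
      ((Commute.refl T).smul_left 4).add_left ((Commute.refl T).mul_left (Commute.refl T))
    exact this.cfcₙ_nnreal _
  set X := (1 / 2 : ℝ) • (T + Z) with hX
  have hXp : X.PosSemidef := (hTp.add hZp).smul (by norm_num)
  have hXX : X * X = T + T * X := by
    rw [hX, smul_mul_smul_comm, Matrix.add_mul, Matrix.mul_add, Matrix.mul_add, hcomm, hZZ,
      Matrix.mul_smul, Matrix.mul_add]
    module
  have hi : W⁻¹ * W = 1 := nonsing_inv_mul _ hWu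
  have hi' : W * W⁻¹ = 1 := mul_nonsing_inv _ hWu
  have hVt : (W⁻¹)ᴴ = W⁻¹ := by rw [conjTranspose_nonsing_inv, hWt]
  have hPp : (W⁻¹ * X * W⁻¹).PosSemidef := by
    have := hXp.mul_mul_conjTranspose_same W⁻¹
    rwa [hVt] at this
  refine ⟨W⁻¹ * X * W⁻¹, hPp, (solvesDARE_one_iff_quadratic hR hPp).2 ?_⟩
  rw [← hMdef]
  have c1 : ∀ Y : Matrix (Fin n) (Fin n) ℝ, W⁻¹ * (W * Y) = Y := fun Y => by
    rw [← Matrix.mul_assoc, hi, Matrix.one_mul]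
  have c2 : ∀ Y : Matrix (Fin n) (Fin n) ℝ, W * (W⁻¹ * Y) = Y := fun Y => by
    rw [← Matrix.mul_assoc, hi', Matrix.one_mul]
  have c3 : W⁻¹ * (X * X) * W⁻¹ = W⁻¹ * (T + T * X) * W⁻¹ := by rw [hXX]
  rw [← hWW]
  simp only [hT, Matrix.mul_add, Matrix.add_mul, Matrix.mul_assoc, c1, c2, hi', Matrix.mul_one]
    at c3 ⊢
  exact c3

/-- A vector in the kernel of `Q` is in the kernel of `P`, hence of the feedback gain. -/
theorem SolvesDARE.mulVec_eq_zero (hR : R.PosDef) (hP : P.PosSemidef)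
    (h : SolvesDARE 1 B Q R P) {x : Fin n → ℝ}
    (hx : x ⬝ᵥ (Q *ᵥ x) = 0) : fbGain 1 B R P *ᵥ x = 0 := by
  have hPt : Pᵀ = P := transpose_eq_of_isHermitian hP.isHermitian
  have hH := posDef_add_transpose_mul_mul (B := B) hR hP
  have hK := mul_fbGain_eq (B := B) hR hP
  rw [solvesDARE_one_iff] at h
  by_contra hne
  have := hH.dotProduct_mulVec_pos hne
  rw [mulVec_mulVec, hK, star_trivial, dotProduct_mulVec_swap, transpose_mul, hPt,
    transpose_transpose, mulVec_mulVec, h, hx] at this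
  exact lt_irrefl _ this

theorem exists_mulVec_eq_zero_of_not_posDef (hQ : Q.PosSemidef) (h : ¬ Q.PosDef) :
    ∃ x ≠ 0, x ⬝ᵥ (Q *ᵥ x) = 0 := by
  by_contra hc
  push Not at hc
  refine h (PosDef.of_dotProduct_mulVec_pos hQ.isHermitian fun x hx => ?_)
  exact lt_of_le_of_ne (hQ.dotProduct_mulVec_nonneg x) (by simpa using (hc x hx).symm)

theorem SolvesDARE.isUnit_mul_fbGain (hQ : Q.PosDef) (h : SolvesDARE 1 B Q R P) :
    IsUnit P ∧ IsUnit (B * fbGain 1 B R P) := by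
  rw [solvesDARE_one_iff] at h
  have := hQ.isUnit
  rw [← h, Matrix.mul_assoc, isUnit_iff_isUnit_det, det_mul, IsUnit.mul_iff] at this
  simpa only [isUnit_iff_isUnit_det] using this

theorem SolvesDARE.isUnit_one_sub_iff
    (hR : R.PosDef) (hP : P.PosSemidef) (hQ : Q.PosSemidef) (h : SolvesDARE 1 B Q R P) :
    IsUnit (1 - (1 - B * fbGain 1 B R P)ᵀ) ↔ Q.PosDef := by
  have e : 1 - (1 - B * fbGain 1 B R P)ᵀ = (B * fbGain 1 B R P)ᵀ := by
    rw [transpose_sub, transpose_one]; abel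
  rw [e, isUnit_iff_isUnit_det, det_transpose, ← isUnit_iff_isUnit_det]
  refine ⟨fun hu => ?_, fun hQ' => (h.isUnit_mul_fbGain hQ').2⟩
  by_contra hQ'
  obtain ⟨x, hx, hx0⟩ := exists_mulVec_eq_zero_of_not_posDef hQ hQ'
  have hK := h.mulVec_eq_zero hR hP hx0
  refine hx (mulVec_injective_of_isUnit hu ?_)
  rw [← mulVec_mulVec, hK, mulVec_zero, mulVec_zero]

/-- The feedforward gain does not depend on `P`: it is the right inverse of `B` whose values have
least `R`-norm. -/
theorem SolvesDARE.ffGain_eq {E : Matrix (Fin m) (Fin n) ℝ} (hE : B * E = 1)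
    (hR : R.PosDef) (hP : P.PosSemidef) (hQ : Q.PosDef) (h : SolvesDARE 1 B Q R P) :
    ffGain 1 B R P = R⁻¹ * Bᵀ * (B * R⁻¹ * Bᵀ)⁻¹ := by
  have hM := (isUnit_iff_isUnit_det _).1 (posDef_mul_inv_mul_transpose hR hE).isUnit
  have hu := (isUnit_iff_isUnit_det _).1 ((h.isUnit_one_sub_iff hR hP hQ.posSemidef).2 hQ)
  have hPt : Pᵀ = P := transpose_eq_of_isHermitian hP.isHermitian
  have hMt : (B * R⁻¹ * Bᵀ)ᵀ = B * R⁻¹ * Bᵀ :=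
    transpose_eq_of_isHermitian (posDef_mul_inv_mul_transpose hR hE).isHermitian
  have hF := congrArg transpose (closedLoop_mul_one_add (B := B) hR hP)
  rw [transpose_mul, transpose_add, transpose_one, transpose_mul, hPt, hMt] at hF
  have hF' := mul_eq_one_comm.1 hF
  have key := inv_mul_transpose_mul_one_add (B := B) hR hP
  unfold ffGain
  set F := 1 - B * fbGain 1 B R P
  set M := B * R⁻¹ * Bᵀ
  have e1 : (1 - Fᵀ) * ((1 + P * M) * M⁻¹) = P := by
    rw [← Matrix.mul_assoc, Matrix.sub_mul, hF', Matrix.one_mul, add_sub_cancel_left,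
      Matrix.mul_assoc, mul_nonsing_inv _ hM, Matrix.mul_one]
  have e2 : (1 - Fᵀ)⁻¹ * P = (1 + P * M) * M⁻¹ := by
    conv_lhs => rw [← e1]
    rw [← Matrix.mul_assoc, nonsing_inv_mul _ hu, Matrix.one_mul]
  rw [Matrix.mul_assoc, e2, ← Matrix.mul_assoc, key]

end Riccati

/-! ### Quadratic forms -/

section QuadraticForms

variable {n m : ℕ}

theorem continuous_quadForm {k : ℕ} (M : Matrix (Fin k) (Fin k) ℝ) :
    Continuous fun x : Fin k → ℝ => x ⬝ᵥ (M *ᵥ x) := by fun_prop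

theorem exists_pos_mul_sq_norm_le {k : ℕ} {M : Matrix (Fin k) (Fin k) ℝ} (hM : M.PosDef) :
    ∃ c > 0, ∀ x : Fin k → ℝ, c * ‖x‖ ^ 2 ≤ x ⬝ᵥ (M *ᵥ x) := by
  rcases (Metric.sphere (0 : Fin k → ℝ) 1).eq_empty_or_nonempty with he | hne
  · refine ⟨1, one_pos, fun x => ?_⟩
    by_cases hx : x = 0
    · simp [hx]
    · exfalso
      have : (‖x‖⁻¹ • x) ∈ Metric.sphere (0 : Fin k → ℝ) 1 := by
        simp [norm_smul, hx]
      rw [he] at this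
      exact this
  · obtain ⟨z, hz, hmin⟩ := (isCompact_sphere (0 : Fin k → ℝ) 1).exists_isMinOn hne
      (continuous_quadForm M).continuousOn
    have hz0 : z ≠ 0 := by
      rintro rfl
      simp at hz
    refine ⟨z ⬝ᵥ (M *ᵥ z), by simpa using hM.dotProduct_mulVec_pos hz0, fun x => ?_⟩
    by_cases hx : x = 0
    · simp [hx]
    · have hxn : 0 < ‖x‖ := norm_pos_iff.2 hx
      have hmem : (‖x‖⁻¹ • x) ∈ Metric.sphere (0 : Fin k → ℝ) 1 := by
        simp [norm_smul, hx]
      have h1 := hmin hmem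
      simp only [Set.mem_ofPred_eq, mulVec_smul, dotProduct_smul, smul_dotProduct,
        smul_eq_mul] at h1
      calc z ⬝ᵥ (M *ᵥ z) * ‖x‖ ^ 2
          ≤ ‖x‖⁻¹ * (‖x‖⁻¹ * x ⬝ᵥ (M *ᵥ x)) * ‖x‖ ^ 2 := by gcongr
        _ = _ := by field_simp

theorem tendsto_zero_of_quadForm {ι : Type*} {l : Filter ι} {k : ℕ}
    {M : Matrix (Fin k) (Fin k) ℝ} (hM : M.PosDef) {x : ι → Fin k → ℝ}
    (h : Tendsto (fun i => x i ⬝ᵥ (M *ᵥ x i)) l (𝓝 0)) : Tendsto x l (𝓝 0) := by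
  obtain ⟨c, hc, hle⟩ := exists_pos_mul_sq_norm_le hM
  rw [tendsto_zero_iff_norm_tendsto_zero]
  have h2 : Tendsto (fun i => ‖x i‖ ^ 2) l (𝓝 0) := by
    refine squeeze_zero (fun i => by positivity) (fun i => ?_)
      (by simpa using h.const_mul c⁻¹)
    rw [le_inv_mul_iff₀ hc]
    exact hle _
  have := h2.sqrt
  simpa [Real.sqrt_sq] using this

theorem tendsto_quadForm_zero {ι : Type*} {l : Filter ι} {k : ℕ}
    (M : Matrix (Fin k) (Fin k) ℝ) {x : ι → Fin k → ℝ} (h : Tendsto x l (𝓝 0)) :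
    Tendsto (fun i => x i ⬝ᵥ (M *ᵥ x i)) l (𝓝 0) := by
  have := ((continuous_quadForm M).tendsto 0).comp h
  simpa [Function.comp_def] using this

theorem tendsto_dotProduct_zero {ι : Type*} {f : Filter ι} {x : ι → Fin n → ℝ}
    (hx : Tendsto x f (𝓝 0)) (l : Fin n → ℝ) : Tendsto (fun i => l ⬝ᵥ x i) f (𝓝 0) := by
  have hc : Continuous fun x : Fin n → ℝ => l ⬝ᵥ x := by fun_prop
  have := (hc.tendsto 0).comp hx
  simpa [Function.comp_def] using this

variable {Q : Matrix (Fin n) (Fin n) ℝ} {R : Matrix (Fin m) (Fin m) ℝ}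

theorem stageCost_nonneg (hQ : Q.PosSemidef) (hR : R.PosSemidef) (x : Fin n → ℝ)
    (u : Fin m → ℝ) : 0 ≤ stageCost Q R x u := by
  have h1 := hQ.dotProduct_mulVec_nonneg x
  have h2 := hR.dotProduct_mulVec_nonneg u
  simp only [star_trivial] at h1 h2
  unfold stageCost
  positivity

theorem tendsto_of_stageCost {ι : Type*} {l : Filter ι} (hQ : Q.PosDef) (hR : R.PosDef)
    {x : ι → Fin n → ℝ} {u : ι → Fin m → ℝ}
    (h : Tendsto (fun i => stageCost Q R (x i) (u i)) l (𝓝 0)) : Tendsto x l (𝓝 0) := by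
  refine tendsto_zero_of_quadForm hQ ?_
  refine squeeze_zero (fun i => by simpa using hQ.posSemidef.dotProduct_mulVec_nonneg (x i))
    (fun i => ?_) (by simpa using h.const_mul 2)
  have h2 := hR.posSemidef.dotProduct_mulVec_nonneg (u i)
  simp only [star_trivial] at h2
  unfold stageCost
  linarith

/-- The stage cost controls the successor state, so that the last stage of a finite horizon
absorbs a linear terminal cost. -/
theorem exists_linear_le_stageCost (hQ : Q.PosDef) (hR : R.PosDef)
    (B : Matrix (Fin n) (Fin m) ℝ) (l : Fin n → ℝ) :
    ∃ C : ℝ, ∀ (x : Fin n → ℝ) (w : Fin m → ℝ),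
      l ⬝ᵥ (x + B *ᵥ w) ≤ stageCost Q R x w + C := by
  obtain ⟨a, ha, hxa⟩ := exists_pos_mul_sq_norm_le hQ
  obtain ⟨b, hb, hwb⟩ := exists_pos_mul_sq_norm_le hR
  obtain ⟨c, hc⟩ : ∃ c : ℝ, ∀ x : Fin n → ℝ, l ⬝ᵥ x ≤ c * ‖x‖ := by
    let f : (Fin n → ℝ) →L[ℝ] ℝ := LinearMap.toContinuousLinearMap (dotProductBilin ℝ ℝ l)
    exact ⟨‖f‖, fun x => (le_abs_self _).trans (f.le_opNorm x)⟩
  obtain ⟨d, hd⟩ : ∃ d : ℝ, ∀ w : Fin m → ℝ, l ⬝ᵥ (B *ᵥ w) ≤ d * ‖w‖ := by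
    let f : (Fin m → ℝ) →L[ℝ] ℝ := LinearMap.toContinuousLinearMap
      ((dotProductBilin ℝ ℝ l) ∘ₗ B.mulVecLin)
    exact ⟨‖f‖, fun x => (le_abs_self _).trans (f.le_opNorm x)⟩
  refine ⟨c ^ 2 / (2 * a) + d ^ 2 / (2 * b), fun x w => ?_⟩
  -- Young's inequality `s t ≤ a t² / 2 + s² / (2 a)` for each of the two linear terms
  have young : ∀ s t a : ℝ, 0 < a → s * t ≤ 1 / 2 * (a * t ^ 2) + s ^ 2 / (2 * a) := by
    intro s t a ha
    have : 1 / 2 * (a * t ^ 2) + s ^ 2 / (2 * a) - s * t = (a * t - s) ^ 2 / (2 * a) := by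
      field_simp; ring
    have h2 : 0 ≤ (a * t - s) ^ 2 / (2 * a) := by positivity
    linarith
  have h1 := young c ‖x‖ a ha
  have h2 := young d ‖w‖ b hb
  have h3 := hxa x
  have h4 := hwb w
  rw [dotProduct_add]
  unfold stageCost
  linarith [hc x, hd w]

end QuadraticForms

/-! ### The undisturbed regulator with a linear terminal cost -/

section Regulator

variable {n m : ℕ}

/-- The data obtained from a solution of the Riccati equation: positive definite weights and the
completion of the square for one step `x ↦ x + B w` of the undisturbed system. -/
structure IsRegulator (B : Matrix (Fin n) (Fin m) ℝ) (Q : Matrix (Fin n) (Fin n) ℝ)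
    (R : Matrix (Fin m) (Fin m) ℝ) (P : Matrix (Fin n) (Fin n) ℝ) (K : Matrix (Fin m) (Fin n) ℝ)
    (H : Matrix (Fin m) (Fin m) ℝ) : Prop where
  posDef_Q : Q.PosDef
  posDef_R : R.PosDef
  posSemidef_P : P.PosSemidef
  posDef_H : H.PosDef
  complete_square : ∀ (x : Fin n → ℝ) (w : Fin m → ℝ),
    x ⬝ᵥ (Q *ᵥ x) + w ⬝ᵥ (R *ᵥ w) =
      x ⬝ᵥ (P *ᵥ x) - (x + B *ᵥ w) ⬝ᵥ (P *ᵥ (x + B *ᵥ w)) +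
        (w + K *ᵥ x) ⬝ᵥ (H *ᵥ (w + K *ᵥ x))

/-- The cost of the first `N` stages of the undisturbed system `x (k+1) = x k + B w k`. -/
noncomputable def runCost (B : Matrix (Fin n) (Fin m) ℝ) (Q : Matrix (Fin n) (Fin n) ℝ)
    (R : Matrix (Fin m) (Fin m) ℝ) (x₀ : Fin n → ℝ) (w : ℕ → Fin m → ℝ) (N : ℕ) : ℝ :=
  ∑ k ∈ Finset.range N, stageCost Q R (state 1 B 0 x₀ w k) (w k)

/-- The input generated by the feedback `w = -K x` in the undisturbed system. -/
noncomputable def feedback (B : Matrix (Fin n) (Fin m) ℝ) (K : Matrix (Fin m) (Fin n) ℝ)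
    (x₀ : Fin n → ℝ) (k : ℕ) : Fin m → ℝ :=
  -(K *ᵥ ((1 - B * K) ^ k *ᵥ x₀))

variable {B : Matrix (Fin n) (Fin m) ℝ} {Q P : Matrix (Fin n) (Fin n) ℝ}
  {R H : Matrix (Fin m) (Fin m) ℝ} {K : Matrix (Fin m) (Fin n) ℝ} {x₀ : Fin n → ℝ}

theorem state_one_succ (e : Fin n → ℝ) (w : ℕ → Fin m → ℝ) (k : ℕ) :
    state 1 B e x₀ w (k + 1) = state 1 B e x₀ w k + B *ᵥ w k + e := by
  rw [state, one_mulVec]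

theorem state_one_zero_succ (w : ℕ → Fin m → ℝ) (k : ℕ) :
    state 1 B 0 x₀ w (k + 1) = state 1 B 0 x₀ w k + B *ᵥ w k := by
  rw [state_one_succ, add_zero]

theorem state_feedback (k : ℕ) :
    state 1 B 0 x₀ (feedback B K x₀) k = (1 - B * K) ^ k *ᵥ x₀ := by
  induction k with
  | zero => simp [state]
  | succ k ih =>
    rw [state_one_zero_succ, ih, feedback, pow_succ', ← mulVec_mulVec, sub_mulVec, one_mulVec,
      mulVec_neg, mulVec_mulVec, ← sub_eq_add_neg]

theorem feedback_eq (k : ℕ) :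
    feedback B K x₀ k = -(K *ᵥ state 1 B 0 x₀ (feedback B K x₀) k) := by
  rw [state_feedback, feedback]

theorem eq_feedback {w : ℕ → Fin m → ℝ}
    (h : ∀ k, w k + K *ᵥ state 1 B 0 x₀ w k = 0) : w = feedback B K x₀ := by
  have key : ∀ k, state 1 B 0 x₀ w k = (1 - B * K) ^ k *ᵥ x₀ := by
    intro k
    induction k with
    | zero => simp [state]
    | succ k ih =>
      rw [state_one_zero_succ, eq_neg_of_add_eq_zero_left (h k), ih, pow_succ', ← mulVec_mulVec,
        sub_mulVec, one_mulVec, mulVec_neg, mulVec_mulVec, ← sub_eq_add_neg]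
  funext k
  rw [feedback, ← key, eq_neg_of_add_eq_zero_left (h k)]

theorem runCost_succ (w : ℕ → Fin m → ℝ) (N : ℕ) :
    runCost B Q R x₀ w (N + 1) =
      runCost B Q R x₀ w N + stageCost Q R (state 1 B 0 x₀ w N) (w N) :=
  Finset.sum_range_succ _ _

namespace IsRegulator

theorem posSemidef_quad (h : IsRegulator B Q R P K H) (x : Fin n → ℝ) :
    0 ≤ x ⬝ᵥ (P *ᵥ x) := by
  simpa using h.posSemidef_P.dotProduct_mulVec_nonneg x

theorem stageCost_nonneg (h : IsRegulator B Q R P K H) (x : Fin n → ℝ) (w : Fin m → ℝ) :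
    0 ≤ stageCost Q R x w :=
  LQ.stageCost_nonneg h.posDef_Q.posSemidef h.posDef_R.posSemidef x w

theorem monotone_runCost (h : IsRegulator B Q R P K H) (w : ℕ → Fin m → ℝ) :
    Monotone (runCost B Q R x₀ w) :=
  monotone_nat_of_le_succ fun N => by
    rw [runCost_succ]
    linarith [h.stageCost_nonneg (state 1 B 0 x₀ w N) (w N)]

/-- The deviation from the feedback law is the only part of the cost that is not a boundary
term. -/
theorem runCost_eq (h : IsRegulator B Q R P K H) (w : ℕ → Fin m → ℝ) (N : ℕ) :
    runCost B Q R x₀ w N =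
      1 / 2 * (x₀ ⬝ᵥ (P *ᵥ x₀)) -
        1 / 2 * (state 1 B 0 x₀ w N ⬝ᵥ (P *ᵥ state 1 B 0 x₀ w N)) +
      ∑ k ∈ Finset.range N, 1 / 2 * ((w k + K *ᵥ state 1 B 0 x₀ w k) ⬝ᵥ
        (H *ᵥ (w k + K *ᵥ state 1 B 0 x₀ w k))) := by
  induction N with
  | zero => simp [runCost, state]
  | succ N ih =>
    rw [runCost_succ, ih, Finset.sum_range_succ, stageCost, h.complete_square,
      state_one_zero_succ]
    ring

theorem deviation_nonneg (h : IsRegulator B Q R P K H) (x : Fin n → ℝ) (w : Fin m → ℝ) :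
    0 ≤ 1 / 2 * ((w + K *ᵥ x) ⬝ᵥ (H *ᵥ (w + K *ᵥ x))) := by
  have := h.posDef_H.posSemidef.dotProduct_mulVec_nonneg (w + K *ᵥ x)
  simp only [star_trivial] at this
  positivity

theorem le_runCost (h : IsRegulator B Q R P K H) (w : ℕ → Fin m → ℝ) (N : ℕ) :
    1 / 2 * (x₀ ⬝ᵥ (P *ᵥ x₀)) -
      1 / 2 * (state 1 B 0 x₀ w N ⬝ᵥ (P *ᵥ state 1 B 0 x₀ w N)) ≤ runCost B Q R x₀ w N := by
  rw [h.runCost_eq]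
  exact le_add_of_nonneg_right (Finset.sum_nonneg fun k _ => h.deviation_nonneg _ _)

theorem runCost_feedback_le (h : IsRegulator B Q R P K H) (N : ℕ) :
    runCost B Q R x₀ (feedback B K x₀) N ≤ 1 / 2 * (x₀ ⬝ᵥ (P *ᵥ x₀)) := by
  rw [h.runCost_eq, Finset.sum_eq_zero]
  · linarith [h.posSemidef_quad (state 1 B 0 x₀ (feedback B K x₀) N)]
  · intro k _
    rw [feedback_eq, neg_add_cancel]
    simp

theorem tendsto_state_of_bddAbove (h : IsRegulator B Q R P K H) {w : ℕ → Fin m → ℝ}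
    (hb : BddAbove (Set.range (runCost B Q R x₀ w))) :
    Tendsto (state 1 B 0 x₀ w) atTop (𝓝 0) := by
  obtain ⟨C, hC⟩ := hb
  have hs : Summable fun k => stageCost Q R (state 1 B 0 x₀ w k) (w k) :=
    summable_of_sum_range_le (fun k => h.stageCost_nonneg _ _) fun N => hC ⟨N, rfl⟩
  exact tendsto_of_stageCost h.posDef_Q h.posDef_R hs.tendsto_atTop_zero

theorem tendsto_state_feedback (h : IsRegulator B Q R P K H) :
    Tendsto (state 1 B 0 x₀ (feedback B K x₀)) atTop (𝓝 0) :=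
  h.tendsto_state_of_bddAbove ⟨_, by rintro _ ⟨N, rfl⟩; exact h.runCost_feedback_le N⟩

/-- A linear terminal cost lowers the running cost by no more than its last stage and a
constant. -/
theorem exists_runCost_le (h : IsRegulator B Q R P K H) (l : Fin n → ℝ) :
    ∃ C : ℝ, ∀ (x₀ : Fin n → ℝ) (w : ℕ → Fin m → ℝ) (N : ℕ), runCost B Q R x₀ w N ≤
      runCost B Q R x₀ w (N + 1) - l ⬝ᵥ state 1 B 0 x₀ w (N + 1) + C := by
  obtain ⟨C, hC⟩ := exists_linear_le_stageCost h.posDef_Q h.posDef_R B l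
  refine ⟨C, fun x₀ w N => ?_⟩
  have := hC (state 1 B 0 x₀ w N) (w N)
  rw [state_one_zero_succ, runCost_succ]
  linarith

/-- The feedback input is overtaking optimal for the tilted cost. An input of bounded cost steers
the state to the origin, which makes the boundary terms vanish; for any other input the cost
exceeds every bound. -/
theorem eventually_feedback_le (h : IsRegulator B Q R P K H) (l : Fin n → ℝ)
    (w : ℕ → Fin m → ℝ) {ε : ℝ} (hε : 0 < ε) :
    ∀ᶠ N in atTop, runCost B Q R x₀ (feedback B K x₀) N
        - l ⬝ᵥ state 1 B 0 x₀ (feedback B K x₀) N ≤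
      runCost B Q R x₀ w N - l ⬝ᵥ state 1 B 0 x₀ w N + ε := by
  have hg := tendsto_dotProduct_zero (h.tendsto_state_feedback (x₀ := x₀)) l
  by_cases hb : BddAbove (Set.range (runCost B Q R x₀ w))
  · have hw := h.tendsto_state_of_bddAbove hb
    have h1 := tendsto_dotProduct_zero hw l
    have h2 := tendsto_quadForm_zero P hw
    have h3 := (h1.add (h2.const_mul (1 / 2))).sub hg
    simp only [mul_zero, add_zero, sub_zero] at h3
    filter_upwards [h3.eventually_lt_const hε] with N hN
    have h4 := h.runCost_feedback_le (x₀ := x₀) N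
    have h5 := h.le_runCost (x₀ := x₀) w N
    linarith
  · obtain ⟨C, hC⟩ := h.exists_runCost_le l
    have ht := tendsto_atTop_atTop_of_monotone' (h.monotone_runCost (x₀ := x₀) w) hb
    obtain ⟨N₁, hN₁⟩ := eventually_atTop.1
      (ht.eventually_ge_atTop (C + 1 / 2 * (x₀ ⬝ᵥ (P *ᵥ x₀)) + 1))
    filter_upwards [hg.eventually_const_lt (show (-1 : ℝ) < 0 by norm_num),
      eventually_ge_atTop (N₁ + 1)] with N hN hN'
    obtain ⟨N, rfl⟩ := Nat.exists_eq_add_of_le' (show 1 ≤ N by omega)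
    have h1 := hN₁ N (by omega)
    linarith [hC x₀ w N, h.runCost_feedback_le (x₀ := x₀) (N + 1)]

/-- An overtaking optimal input has bounded cost, and its accumulated deviation from the feedback
law is smaller than every positive number. -/
theorem eq_feedback_of_overtaking (h : IsRegulator B Q R P K H) (l : Fin n → ℝ)
    {w : ℕ → Fin m → ℝ} (ho : ∀ ε : ℝ, 0 < ε → ∀ᶠ N in atTop,
      runCost B Q R x₀ w N - l ⬝ᵥ state 1 B 0 x₀ w N ≤
        runCost B Q R x₀ (feedback B K x₀) N
          - l ⬝ᵥ state 1 B 0 x₀ (feedback B K x₀) N + ε) :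
    w = feedback B K x₀ := by
  have hg := tendsto_dotProduct_zero (h.tendsto_state_feedback (x₀ := x₀)) l
  obtain ⟨C, hC⟩ := h.exists_runCost_le l
  have hb : BddAbove (Set.range (runCost B Q R x₀ w)) := by
    have h1 := (ho 1 one_pos).and (hg.eventually_const_lt (show (-1 : ℝ) < 0 by norm_num))
    obtain ⟨N₀, hN₀⟩ := eventually_atTop.1 h1
    refine ⟨1 / 2 * (x₀ ⬝ᵥ (P *ᵥ x₀)) + 2 + C, ?_⟩
    rintro _ ⟨N, rfl⟩
    obtain ⟨a1, a2⟩ := hN₀ (max N N₀ + 1) (by omega)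
    have a3 := h.monotone_runCost (x₀ := x₀) w (le_max_left N N₀)
    linarith [hC x₀ w (max N N₀), h.runCost_feedback_le (x₀ := x₀) (max N N₀ + 1)]
  have hw := h.tendsto_state_of_bddAbove hb
  refine eq_feedback fun k => ?_
  by_contra hne
  have hpos := h.posDef_H.dotProduct_mulVec_pos hne
  rw [star_trivial] at hpos
  set d := (w k + K *ᵥ state 1 B 0 x₀ w k) ⬝ᵥ (H *ᵥ (w k + K *ᵥ state 1 B 0 x₀ w k)) with hd
  have h3 := ((tendsto_dotProduct_zero hw l).add
    ((tendsto_quadForm_zero P hw).const_mul (1 / 2))).sub hg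
  simp only [mul_zero, add_zero, sub_zero] at h3
  obtain ⟨N, ⟨hN1, hN2⟩, hN3⟩ := (((ho (d / 8) (by linarith)).and
    (h3.eventually_lt_const (show 0 < d / 8 by linarith))).and (eventually_gt_atTop k)).exists
  have h4 := h.runCost_eq (x₀ := x₀) w N
  have h5 : 1 / 2 * d ≤ _ := Finset.single_le_sum
    (f := fun k => 1 / 2 * ((w k + K *ᵥ state 1 B 0 x₀ w k) ⬝ᵥ
        (H *ᵥ (w k + K *ᵥ state 1 B 0 x₀ w k))))
    (fun j _ => h.deviation_nonneg _ _) (Finset.mem_range.2 hN3)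
  linarith [h.runCost_feedback_le (x₀ := x₀) N]

end IsRegulator

end Regulator

/-! ### Existence of finite-horizon minimizers -/

section Existence

variable {n m : ℕ} {A : Matrix (Fin n) (Fin n) ℝ} {B : Matrix (Fin n) (Fin m) ℝ}
  {Q S : Matrix (Fin n) (Fin n) ℝ} {R : Matrix (Fin m) (Fin m) ℝ} {e x₀ : Fin n → ℝ}

theorem state_congr {u v : ℕ → Fin m → ℝ} {N : ℕ} (h : ∀ k < N, u k = v k) :
    state A B e x₀ u N = state A B e x₀ v N := by
  induction N with
  | zero => rfl
  | succ N ih => rw [state, state, ih fun k hk => h k (by omega), h N (by omega)]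

theorem finiteCost_congr {u v : ℕ → Fin m → ℝ} {N : ℕ} (h : ∀ k < N, u k = v k) :
    finiteCost A B Q R e x₀ S N u = finiteCost A B Q R e x₀ S N v := by
  unfold finiteCost
  rw [state_congr h]
  congr 1
  refine Finset.sum_congr rfl fun k hk => ?_
  have hk := Finset.mem_range.1 hk
  rw [state_congr fun j hj => h j (hj.trans hk), h k hk]

/-- The cost is continuous in the finitely many inputs that matter, and coercive because `R` is
positive definite. -/
theorem exists_isFiniteOptimal (hQ : Q.PosSemidef) (hR : R.PosDef) (hS : S.PosSemidef) (N : ℕ) :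
    ∃ u, IsFiniteOptimal A B Q R e x₀ S N u := by
  let ext : (Fin N → Fin m → ℝ) → ℕ → Fin m → ℝ := fun f k => if h : k < N then f ⟨k, h⟩ else 0
  have hext : ∀ k, Continuous fun f => ext f k := by
    intro k
    by_cases h : k < N
    · simpa only [ext, h, dite_true] using continuous_apply (⟨k, h⟩ : Fin N)
    · simpa only [ext, h, dite_false] using continuous_const
  have hstate : ∀ k, Continuous fun f => state A B e x₀ (ext f) k := by
    intro k
    induction k with
    | zero => exact continuous_const
    | succ k ih =>
      simp only [state]
      exact ((continuous_const.matrix_mulVec ih).add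
        (continuous_const.matrix_mulVec (hext k))).add continuous_const
  have hquad : ∀ {k : ℕ} (M : Matrix (Fin k) (Fin k) ℝ) {z : (Fin N → Fin m → ℝ) → Fin k → ℝ},
      Continuous z → Continuous fun f => z f ⬝ᵥ (M *ᵥ z f) := fun M _ hz =>
    (continuous_quadForm M).comp hz
  have hcont : Continuous fun f => finiteCost A B Q R e x₀ S N (ext f) := by
    unfold finiteCost stageCost
    exact (continuous_const.mul (hquad S (hstate N))).add (continuous_finsetSum _ fun k _ =>
      continuous_const.mul ((hquad Q (hstate k)).add (hquad R (hext k))))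
  obtain ⟨c, hc, hle⟩ := exists_pos_mul_sq_norm_le hR
  have hcoer : ∀ f, c / 2 * ‖f‖ ^ 2 ≤ finiteCost A B Q R e x₀ S N (ext f) := by
    intro f
    have h0 : 0 ≤ 1 / 2 * (state A B e x₀ (ext f) N ⬝ᵥ (S *ᵥ state A B e x₀ (ext f) N)) := by
      have := hS.dotProduct_mulVec_nonneg (state A B e x₀ (ext f) N)
      rw [star_trivial] at this
      positivity
    have hcost : 0 ≤ finiteCost A B Q R e x₀ S N (ext f) :=
      add_nonneg h0 (Finset.sum_nonneg fun k _ => stageCost_nonneg hQ hR.posSemidef _ _)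
    have hcoord : ‖f‖ ≤ √(2 / c * finiteCost A B Q R e x₀ S N (ext f)) := by
      refine (pi_norm_le_iff_of_nonneg (Real.sqrt_nonneg _)).2 fun i => Real.le_sqrt_of_sq_le ?_
      have h1 : stageCost Q R (state A B e x₀ (ext f) i) (ext f i) ≤
          finiteCost A B Q R e x₀ S N (ext f) :=
        (Finset.single_le_sum (f := fun k => stageCost Q R (state A B e x₀ (ext f) k) (ext f k))
          (fun k _ => stageCost_nonneg hQ hR.posSemidef _ _)
          (Finset.mem_range.2 i.2)).trans (le_add_of_nonneg_left h0)
      have h2 : ext f i = f i := by simp [ext]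
      have h3 := hQ.dotProduct_mulVec_nonneg (state A B e x₀ (ext f) i)
      rw [star_trivial] at h3
      rw [stageCost, h2] at h1
      rw [div_mul_eq_mul_div, le_div_iff₀ hc]
      linarith [hle (f i)]
    have := pow_le_pow_left₀ (norm_nonneg f) hcoord 2
    rw [Real.sq_sqrt (by positivity), div_mul_eq_mul_div, le_div_iff₀ hc] at this
    linarith
  have htop : Tendsto (fun f => finiteCost A B Q R e x₀ S N (ext f))
      (cocompact (Fin N → Fin m → ℝ)) atTop :=
    tendsto_atTop_mono hcoer (((tendsto_pow_atTop two_ne_zero).comp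
      (tendsto_norm_cocompact_atTop (E := Fin N → Fin m → ℝ))).const_mul_atTop (half_pos hc))
  obtain ⟨f, hf⟩ := hcont.exists_forall_le htop
  refine ⟨ext f, fun v => ?_⟩
  have hv : finiteCost A B Q R e x₀ S N v =
      finiteCost A B Q R e x₀ S N (ext fun k : Fin N => v k) :=
    finiteCost_congr fun k hk => by simp [ext, hk]
  rw [hv]
  exact hf (fun k : Fin N => v k)

end Existence

/-! ### Convergence of finite-horizon minimizers -/

section Turnpike

variable {n m : ℕ}

/-- The cost of horizon `N` of the undisturbed system with terminal cost
`xᵀ S x / 2 - lᵀ x`. -/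
noncomputable def tiltedCost (B : Matrix (Fin n) (Fin m) ℝ) (Q : Matrix (Fin n) (Fin n) ℝ)
    (R : Matrix (Fin m) (Fin m) ℝ) (x₀ : Fin n → ℝ) (S : Matrix (Fin n) (Fin n) ℝ)
    (l : Fin n → ℝ) (N : ℕ) (w : ℕ → Fin m → ℝ) : ℝ :=
  1 / 2 * (state 1 B 0 x₀ w N ⬝ᵥ (S *ᵥ state 1 B 0 x₀ w N)) + runCost B Q R x₀ w N
    - l ⬝ᵥ state 1 B 0 x₀ w N

/-- The input that follows `g` before time `i` and `w` after time `i`; when `E` is a right inverse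
of `B`, its value at time `i` makes the trajectory jump onto that of `w`. -/
noncomputable def splice (B : Matrix (Fin n) (Fin m) ℝ) (E : Matrix (Fin m) (Fin n) ℝ)
    (x₀ : Fin n → ℝ) (g w : ℕ → Fin m → ℝ) (i k : ℕ) : Fin m → ℝ :=
  if k < i then g k else
    if k = i then E *ᵥ (state 1 B 0 x₀ w (i + 1) - state 1 B 0 x₀ g i) else w k

variable {B : Matrix (Fin n) (Fin m) ℝ} {Q P S : Matrix (Fin n) (Fin n) ℝ}
  {R H : Matrix (Fin m) (Fin m) ℝ} {K E : Matrix (Fin m) (Fin n) ℝ} {x₀ l : Fin n → ℝ}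

theorem state_splice_of_le {g w : ℕ → Fin m → ℝ} {i k : ℕ} (hk : k ≤ i) :
    state 1 B 0 x₀ (splice B E x₀ g w i) k = state 1 B 0 x₀ g k :=
  state_congr fun j hj => by rw [splice, if_pos (by omega)]

theorem splice_self {g w : ℕ → Fin m → ℝ} {i : ℕ} :
    splice B E x₀ g w i i = E *ᵥ (state 1 B 0 x₀ w (i + 1) - state 1 B 0 x₀ g i) := by
  rw [splice, if_neg (lt_irrefl i), if_pos rfl]

theorem splice_of_lt {g w : ℕ → Fin m → ℝ} {i k : ℕ} (hk : i < k) :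
    splice B E x₀ g w i k = w k := by
  rw [splice, if_neg (by omega), if_neg (by omega)]

theorem state_splice_of_lt (hE : B * E = 1) {g w : ℕ → Fin m → ℝ} {i k : ℕ} (hk : i + 1 ≤ k) :
    state 1 B 0 x₀ (splice B E x₀ g w i) k = state 1 B 0 x₀ w k := by
  induction k, hk using Nat.le_induction with
  | base =>
    rw [state_one_zero_succ, state_splice_of_le le_rfl, splice_self, mulVec_mulVec, hE, one_mulVec,
      add_sub_cancel]
  | succ k hk ih =>
    rw [state_one_zero_succ, ih, splice_of_lt (by omega), ← state_one_zero_succ]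

theorem runCost_splice_sub (hE : B * E = 1) {g w : ℕ → Fin m → ℝ} {i N : ℕ} (hN : i + 1 ≤ N) :
    runCost B Q R x₀ (splice B E x₀ g w i) N - runCost B Q R x₀ w N =
      runCost B Q R x₀ g i +
        stageCost Q R (state 1 B 0 x₀ g i)
          (E *ᵥ (state 1 B 0 x₀ w (i + 1) - state 1 B 0 x₀ g i)) -
        runCost B Q R x₀ w (i + 1) := by
  induction N, hN using Nat.le_induction with
  | base =>
    rw [runCost_succ (splice B E x₀ g w i), splice_self, state_splice_of_le le_rfl]
    congr 2
    refine Finset.sum_congr rfl fun k hk => ?_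
    have hk := Finset.mem_range.1 hk
    rw [state_splice_of_le hk.le, splice, if_pos hk]
  | succ k hk ih =>
    rw [runCost_succ, runCost_succ w, splice_of_lt (by omega), state_splice_of_lt hE hk, ← ih]
    ring

/-- A minimizer of horizon `N` cannot do worse up to time `i + 1` than following `g` for `i` steps
and then jumping to the state it visits at time `i + 1`. -/
theorem runCost_le_of_minimizer (hE : B * E = 1) (g : ℕ → Fin m → ℝ) {w : ℕ → Fin m → ℝ}
    {i N : ℕ} (hN : i + 1 ≤ N)
    (hw : ∀ v, tiltedCost B Q R x₀ S l N w ≤ tiltedCost B Q R x₀ S l N v) :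
    runCost B Q R x₀ w (i + 1) ≤ runCost B Q R x₀ g i +
      stageCost Q R (state 1 B 0 x₀ g i)
        (E *ᵥ (state 1 B 0 x₀ w (i + 1) - state 1 B 0 x₀ g i)) := by
  have h1 := hw (splice B E x₀ g w i)
  have h2 := runCost_splice_sub (Q := Q) (R := R) (x₀ := x₀) hE (g := g) (w := w) hN
  unfold tiltedCost at h1
  rw [state_splice_of_lt hE hN] at h1
  linarith

namespace IsRegulator

/-- Up to the last stage, the running costs of minimizers are bounded uniformly in the horizon. -/
theorem exists_runCost_minimizer_le (h : IsRegulator B Q R P K H) (hS : S.PosSemidef)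
    (x₀ l : Fin n → ℝ) : ∃ C : ℝ, ∀ (N : ℕ) (w : ℕ → Fin m → ℝ),
      (∀ v, tiltedCost B Q R x₀ S l (N + 1) w ≤ tiltedCost B Q R x₀ S l (N + 1) v) →
      runCost B Q R x₀ w N ≤ C := by
  obtain ⟨C, hC⟩ := h.exists_runCost_le l
  have hg := h.tendsto_state_feedback (x₀ := x₀)
  obtain ⟨D, hD⟩ := (((tendsto_quadForm_zero S hg).const_mul (1 / 2)).sub
    (tendsto_dotProduct_zero hg l)).bddAbove_range
  refine ⟨D + 1 / 2 * (x₀ ⬝ᵥ (P *ᵥ x₀)) + C, fun N w hw => ?_⟩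
  have h1 := hw (feedback B K x₀)
  have h2 := hC x₀ w N
  have h3 := hD ⟨N + 1, rfl⟩
  have h4 := h.runCost_feedback_le (x₀ := x₀) (N + 1)
  have h5 := hS.dotProduct_mulVec_nonneg (state 1 B 0 x₀ w (N + 1))
  rw [star_trivial] at h5
  simp only [tiltedCost] at h1 h3
  linarith

/-- The turnpike property: minimizers come close to the origin at some time in the second half of
the horizon. -/
theorem exists_turnpike (h : IsRegulator B Q R P K H) (hS : S.PosSemidef)
    {w : ℕ → ℕ → Fin m → ℝ}
    (hw : ∀ N v, tiltedCost B Q R x₀ S l N (w N) ≤ tiltedCost B Q R x₀ S l N v) :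
    ∃ i : ℕ → ℕ, Tendsto i atTop atTop ∧ (∀ᶠ N in atTop, i N + 1 ≤ N) ∧
      Tendsto (fun N => state 1 B 0 x₀ (w N) (i N + 1)) atTop (𝓝 0) := by
  obtain ⟨C, hC⟩ := h.exists_runCost_minimizer_le hS x₀ l
  have key : ∀ N, ∃ i, 3 ≤ N → N / 2 ≤ i + 1 ∧ i + 1 ≤ N ∧
      stageCost Q R (state 1 B 0 x₀ (w N) (i + 1)) (w N (i + 1)) ≤ C / ((N : ℝ) / 2 - 1) := by
    intro N
    by_cases hN : 3 ≤ N
    · by_contra hcon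
      push Not at hcon
      have hN' : (0 : ℝ) < (N : ℝ) / 2 - 1 := by
        have : (3 : ℝ) ≤ N := by exact_mod_cast hN
        linarith
      have hlt : ∀ j ∈ Finset.Ico (N / 2) (N - 1), C / ((N : ℝ) / 2 - 1) <
          stageCost Q R (state 1 B 0 x₀ (w N) j) (w N j) := by
        intro j hj
        rw [Finset.mem_Ico] at hj
        obtain ⟨i, rfl⟩ := Nat.exists_eq_add_of_le' (show 1 ≤ j by omega)
        exact (hcon i).2 (by omega) (by omega)
      have hsum := Finset.sum_lt_sum_of_nonempty
        (Finset.nonempty_Ico.2 (show N / 2 < N - 1 by omega)) hlt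
      have hrun := hC (N - 1) (w N) (by rw [Nat.sub_add_cancel (by omega)]; exact hw N)
      have hsub : ∑ j ∈ Finset.Ico (N / 2) (N - 1),
          stageCost Q R (state 1 B 0 x₀ (w N) j) (w N j) ≤ runCost B Q R x₀ (w N) (N - 1) :=
        Finset.sum_le_sum_of_subset_of_nonneg
          (fun j hj => Finset.mem_range.2 (Finset.mem_Ico.1 hj).2)
          (fun j _ _ => h.stageCost_nonneg _ _)
      have hC0 : 0 ≤ C := le_trans (Finset.sum_nonneg fun _ _ => h.stageCost_nonneg _ _) hrun
      have hcard : (N : ℝ) / 2 - 1 ≤ ((N - 1 - N / 2 : ℕ) : ℝ) := by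
        have : N ≤ 2 * (N - 1 - N / 2) + 2 := by omega
        have : (N : ℝ) ≤ 2 * ((N - 1 - N / 2 : ℕ) : ℝ) + 2 := by exact_mod_cast this
        linarith
      rw [Finset.sum_const, Nat.card_Ico, nsmul_eq_mul] at hsum
      have : C ≤ ((N - 1 - N / 2 : ℕ) : ℝ) * (C / ((N : ℝ) / 2 - 1)) := by
        calc C = ((N : ℝ) / 2 - 1) * (C / ((N : ℝ) / 2 - 1)) :=
              (mul_div_cancel₀ _ hN'.ne').symm
          _ ≤ _ := by gcongr
      linarith
    · exact ⟨0, fun h => absurd h hN⟩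
  choose i hi using key
  refine ⟨i, ?_, ?_, ?_⟩
  · refine tendsto_atTop.2 fun b => ?_
    filter_upwards [eventually_ge_atTop (2 * b + 3)] with N hN
    have := (hi N (by omega)).1
    omega
  · filter_upwards [eventually_ge_atTop 3] with N hN using (hi N hN).2.1
  · refine tendsto_of_stageCost h.posDef_Q h.posDef_R (u := fun N => w N (i N + 1)) ?_
    have hden : Tendsto (fun N : ℕ => (N : ℝ) / 2 - 1) atTop atTop :=
      tendsto_atTop_add_const_right _ _
        (tendsto_natCast_atTop_atTop.atTop_div_const two_pos)
    refine squeeze_zero' (Eventually.of_forall fun N => h.stageCost_nonneg _ _) ?_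
      (hden.const_div_atTop C)
    filter_upwards [eventually_ge_atTop 3] with N hN using (hi N hN).2.2

/-- Comparison with the input that follows the feedback law until the turnpike is reached shows
that the deviations of the minimizers from the feedback law tend to zero. -/
theorem tendsto_deviation (h : IsRegulator B Q R P K H) (hE : B * E = 1) (hS : S.PosSemidef)
    {w : ℕ → ℕ → Fin m → ℝ}
    (hw : ∀ N v, tiltedCost B Q R x₀ S l N (w N) ≤ tiltedCost B Q R x₀ S l N v) (k : ℕ) :
    Tendsto (fun N => w N k + K *ᵥ state 1 B 0 x₀ (w N) k) atTop (𝓝 0) := by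
  obtain ⟨i, hi, hiN, hx⟩ := h.exists_turnpike hS hw
  have hy : Tendsto (fun N => state 1 B 0 x₀ (feedback B K x₀) (i N)) atTop (𝓝 0) :=
    h.tendsto_state_feedback.comp hi
  have hu : Tendsto (fun N => E *ᵥ (state 1 B 0 x₀ (w N) (i N + 1) -
      state 1 B 0 x₀ (feedback B K x₀) (i N))) atTop (𝓝 0) := by
    have hc : Continuous fun z : Fin n → ℝ => E *ᵥ z := by fun_prop
    have := (hc.tendsto 0).comp (by simpa using hx.sub hy)
    simpa [Function.comp_def] using this
  have hbound := ((((tendsto_quadForm_zero Q hy).add (tendsto_quadForm_zero R hu)).const_mul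
    (1 / 2)).add ((tendsto_quadForm_zero P hx).const_mul (1 / 2))).const_mul 2
  simp only [mul_zero, add_zero] at hbound
  refine tendsto_zero_of_quadForm h.posDef_H (squeeze_zero' ?_ ?_ hbound)
  · exact Eventually.of_forall fun N => by
      simpa using h.posDef_H.posSemidef.dotProduct_mulVec_nonneg
        (w N k + K *ᵥ state 1 B 0 x₀ (w N) k)
  · filter_upwards [hiN, hi.eventually_ge_atTop k] with N hN hk
    have h1 := runCost_le_of_minimizer hE (feedback B K x₀) hN (hw N)
    have h2 := h.runCost_feedback_le (x₀ := x₀) (i N)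
    have h3 := h.runCost_eq (x₀ := x₀) (w N) (i N + 1)
    have h4 := Finset.single_le_sum
      (f := fun k => 1 / 2 * ((w N k + K *ᵥ state 1 B 0 x₀ (w N) k) ⬝ᵥ
        (H *ᵥ (w N k + K *ᵥ state 1 B 0 x₀ (w N) k))))
      (fun j _ => h.deviation_nonneg _ _) (Finset.mem_range.2 (Nat.lt_succ_of_le hk))
    rw [stageCost] at h1
    simp only [Nat.succ_eq_add_one] at h4
    linarith

theorem tendsto_minimizer (h : IsRegulator B Q R P K H) (hE : B * E = 1) (hS : S.PosSemidef)
    {w : ℕ → ℕ → Fin m → ℝ}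
    (hw : ∀ N v, tiltedCost B Q R x₀ S l N (w N) ≤ tiltedCost B Q R x₀ S l N v) (k : ℕ) :
    Tendsto (fun N => w N k) atTop (𝓝 (feedback B K x₀ k)) := by
  have hKc : Continuous fun z : Fin n → ℝ => K *ᵥ z := by fun_prop
  have hBc : Continuous fun z : Fin m → ℝ => B *ᵥ z := by fun_prop
  have hinput : ∀ k, Tendsto (fun N => state 1 B 0 x₀ (w N) k) atTop
      (𝓝 (state 1 B 0 x₀ (feedback B K x₀) k)) →
      Tendsto (fun N => w N k) atTop (𝓝 (feedback B K x₀ k)) := by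
    intro k hk
    have := (h.tendsto_deviation hE hS hw k).sub ((hKc.tendsto _).comp hk)
    simpa [Function.comp_def, ← feedback_eq] using this
  refine hinput k ?_
  induction k with
  | zero => exact tendsto_const_nhds
  | succ k ih =>
    simp only [state_one_zero_succ]
    exact ih.add ((hBc.tendsto _).comp (hinput k ih))

end IsRegulator

end Turnpike

/-! ### Stability of the closed loop -/

section Stability

variable {n m : ℕ} {B : Matrix (Fin n) (Fin m) ℝ} {Q P : Matrix (Fin n) (Fin n) ℝ}
  {R H : Matrix (Fin m) (Fin m) ℝ} {K : Matrix (Fin m) (Fin n) ℝ}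

/-- Along an eigenvector for `z`, the powers of `F` act as `z ^ k`. -/
theorem isStable_of_tendsto_pow {F : Matrix (Fin n) (Fin n) ℝ}
    (h : ∀ x : Fin n → ℝ, Tendsto (fun k => F ^ k *ᵥ x) atTop (𝓝 0)) : IsStable F := by
  have hpow : Tendsto (fun k => F ^ k) atTop (𝓝 0) := by
    refine tendsto_pi_nhds.2 fun i => tendsto_pi_nhds.2 fun j => ?_
    have := tendsto_pi_nhds.1 (h (Pi.single j 1)) i
    simpa using this
  intro z hz
  rw [← spectrum_toLin', ← Module.End.hasEigenvalue_iff_mem_spectrum] at hz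
  obtain ⟨v, hv⟩ := hz.exists_hasEigenvector
  obtain ⟨i, hi⟩ := Function.ne_iff.1 hv.2
  have hFv : ∀ k, (F ^ k).map (algebraMap ℝ ℂ) *ᵥ v = z ^ k • v := by
    intro k
    have h1 : (F ^ k).map (algebraMap ℝ ℂ) = (F.map (algebraMap ℝ ℂ)) ^ k :=
      map_pow (algebraMap ℝ ℂ).mapMatrix F k
    have h2 := hv.pow_apply k
    rwa [← toLin'_pow, toLin'_apply, ← h1] at h2
  have hc : Continuous fun X : Matrix (Fin n) (Fin n) ℝ =>
      (X.map (algebraMap ℝ ℂ) *ᵥ v) i :=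
    (continuous_apply i).comp ((continuous_id.matrix_map
      (Complex.continuous_ofReal)).matrix_mulVec continuous_const)
  have hlim := (hc.tendsto 0).comp hpow
  have h0 : ((0 : Matrix (Fin n) (Fin n) ℝ).map (algebraMap ℝ ℂ) *ᵥ v) i = 0 := by
    rw [Matrix.map_zero _ (map_zero _), zero_mulVec, Pi.zero_apply]
  simp only [Function.comp_def, h0, hFv, Pi.smul_apply, smul_eq_mul] at hlim
  have hz0 : Tendsto (fun k => z ^ k) atTop (𝓝 0) := by
    have := hlim.mul_const (v i)⁻¹
    simpa [mul_assoc, mul_inv_cancel₀ hi] using this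
  exact tendsto_pow_atTop_nhds_zero_iff_norm_lt_one.1 hz0

theorem not_isStable_of_mulVec_eq {F : Matrix (Fin n) (Fin n) ℝ} {x : Fin n → ℝ} (hx : x ≠ 0)
    (hF : F *ᵥ x = x) : ¬ IsStable F := by
  intro h
  have h1 : (1 : ℂ) ∈ spectrum ℂ (F.map (algebraMap ℝ ℂ)) := by
    rw [← spectrum_toLin', ← Module.End.hasEigenvalue_iff_mem_spectrum]
    refine Module.End.hasEigenvalue_of_hasEigenvector (x := fun i => algebraMap ℝ ℂ (x i))
      (Module.End.hasEigenvector_iff.2 ⟨Module.End.mem_eigenspace_iff.2 ?_, ?_⟩)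
    · rw [toLin'_apply, one_smul]
      funext i
      have := RingHom.map_mulVec (algebraMap ℝ ℂ) F x i
      rw [hF] at this
      exact this.symm
    · intro h0
      refine hx (funext fun i => ?_)
      simpa using congrFun h0 i
  simpa using h 1 h1

theorem SolvesDARE.isRegulator (hQ : Q.PosDef) (hR : R.PosDef) (hP : P.PosSemidef)
    (h : SolvesDARE 1 B Q R P) :
    IsRegulator B Q R P (fbGain 1 B R P) (R + Bᵀ * P * B) where
  posDef_Q := hQ
  posDef_R := hR
  posSemidef_P := hP
  posDef_H := posDef_add_transpose_mul_mul hR hP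
  complete_square := h.complete_square hR hP

theorem SolvesDARE.isStable_iff (hR : R.PosDef) (hP : P.PosSemidef) (hQ : Q.PosSemidef)
    (h : SolvesDARE 1 B Q R P) : IsStable (1 - B * fbGain 1 B R P) ↔ Q.PosDef := by
  refine ⟨fun hs => ?_, fun hQ' => isStable_of_tendsto_pow fun x => ?_⟩
  · by_contra hQ'
    obtain ⟨x, hx, hx0⟩ := exists_mulVec_eq_zero_of_not_posDef hQ hQ'
    have hK := h.mulVec_eq_zero hR hP hx0
    refine not_isStable_of_mulVec_eq hx ?_ hs
    rw [sub_mulVec, one_mulVec, ← mulVec_mulVec, hK, mulVec_zero, sub_zero]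
  · have := (h.isRegulator hQ' hR hP).tendsto_state_feedback (x₀ := x)
    exact this.congr fun k => state_feedback k

end Stability

/-! ### Removing the disturbance -/

section Shift

variable {n m : ℕ} {B : Matrix (Fin n) (Fin m) ℝ} {Q P S : Matrix (Fin n) (Fin n) ℝ}
  {R H : Matrix (Fin m) (Fin m) ℝ} {K : Matrix (Fin m) (Fin n) ℝ} {e l x₀ : Fin n → ℝ}
  {κ : Fin m → ℝ}

theorem state_eq_state_shift (hB : B *ᵥ κ = e) (u : ℕ → Fin m → ℝ) (k : ℕ) :
    state 1 B e x₀ u k = state 1 B 0 x₀ (fun j => u j + κ) k := by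
  induction k with
  | zero => rfl
  | succ k ih => rw [state_one_succ, state_one_zero_succ, ih, mulVec_add, hB, add_assoc]

/-- If `κ` cancels the disturbance and `R κ = Bᵀ l`, then the cross terms of `R` between `κ` and
the shifted input telescope to a linear function of the terminal state. -/
theorem finiteCost_eq_tiltedCost (hR : R.PosDef) (hB : B *ᵥ κ = e) (hl : R *ᵥ κ = Bᵀ *ᵥ l)
    (N : ℕ) (u : ℕ → Fin m → ℝ) :
    finiteCost 1 B Q R e x₀ S N u = tiltedCost B Q R x₀ S l N (fun j => u j + κ) +
      (l ⬝ᵥ x₀ + N * (1 / 2 * (κ ⬝ᵥ (R *ᵥ κ)))) := by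
  have hRt := transpose_eq_of_isHermitian hR.isHermitian
  have key : ∑ k ∈ Finset.range N, stageCost Q R (state 1 B e x₀ u k) (u k) =
      runCost B Q R x₀ (fun j => u j + κ) N
        - l ⬝ᵥ state 1 B 0 x₀ (fun j => u j + κ) N +
        (l ⬝ᵥ x₀ + N * (1 / 2 * (κ ⬝ᵥ (R *ᵥ κ)))) := by
    induction N with
    | zero => simp [runCost, state]
    | succ N ih =>
      have e1 : u N ⬝ᵥ (R *ᵥ κ) = l ⬝ᵥ (B *ᵥ u N) := by rw [hl, ← dotProduct_mulVec_swap]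
      have e2 : κ ⬝ᵥ (R *ᵥ u N) = l ⬝ᵥ (B *ᵥ u N) := by
        rw [dotProduct_mulVec_swap, hRt, e1]
      have e3 : κ ⬝ᵥ (R *ᵥ κ) = l ⬝ᵥ (B *ᵥ κ) := by rw [hl, ← dotProduct_mulVec_swap]
      rw [Finset.sum_range_succ, ih, runCost_succ, state_one_zero_succ,
        state_eq_state_shift hB]
      simp only [stageCost, mulVec_add, dotProduct_add, add_dotProduct, e1, e2, e3]
      push_cast
      ring
  rw [finiteCost, key, tiltedCost, state_eq_state_shift hB]
  ring

theorem tiltedCost_zero (w : ℕ → Fin m → ℝ) (N : ℕ) :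
    tiltedCost B Q R x₀ 0 l N w = runCost B Q R x₀ w N - l ⬝ᵥ state 1 B 0 x₀ w N := by
  simp [tiltedCost]

namespace IsRegulator

theorem isOvertakingOptimal_iff (h : IsRegulator B Q R P K H) (hB : B *ᵥ κ = e)
    (hl : R *ᵥ κ = Bᵀ *ᵥ l) (v : ℕ → Fin m → ℝ) :
    IsOvertakingOptimal 1 B Q R e x₀ v ↔ v = fun k => feedback B K x₀ k - κ := by
  have hshift : (fun j => (fun k => feedback B K x₀ k - κ) j + κ) = feedback B K x₀ :=
    funext fun j => sub_add_cancel _ _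
  constructor
  · intro ho
    have := h.eq_feedback_of_overtaking (x₀ := x₀) l (w := fun j => v j + κ) fun ε hε => by
      filter_upwards [ho (fun k => feedback B K x₀ k - κ) ε hε] with N hN
      rw [finiteCost_eq_tiltedCost h.posDef_R hB hl, finiteCost_eq_tiltedCost h.posDef_R hB hl,
        hshift, tiltedCost_zero, tiltedCost_zero] at hN
      linarith
    funext k
    rw [← this, add_sub_cancel_right]
  · rintro rfl v ε hε
    filter_upwards [h.eventually_feedback_le (x₀ := x₀) l (fun j => v j + κ) hε] with N hN
    rw [finiteCost_eq_tiltedCost h.posDef_R hB hl, finiteCost_eq_tiltedCost h.posDef_R hB hl,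
      hshift, tiltedCost_zero, tiltedCost_zero]
    linarith

theorem tendsto_isFiniteOptimal (h : IsRegulator B Q R P K H) {E : Matrix (Fin m) (Fin n) ℝ}
    (hE : B * E = 1) (hS : S.PosSemidef) (hB : B *ᵥ κ = e) (hl : R *ᵥ κ = Bᵀ *ᵥ l)
    {w : ℕ → ℕ → Fin m → ℝ} (hw : ∀ N, IsFiniteOptimal 1 B Q R e x₀ S N (w N)) (k : ℕ) :
    Tendsto (fun N => w N k) atTop (𝓝 (feedback B K x₀ k - κ)) := by
  have := h.tendsto_minimizer (x₀ := x₀) (l := l) hE hS (w := fun N j => w N j + κ)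
    (fun N v => by
      have := hw N (fun j => v j - κ)
      rw [finiteCost_eq_tiltedCost h.posDef_R hB hl, finiteCost_eq_tiltedCost h.posDef_R hB hl]
        at this
      simp only [sub_add_cancel] at this
      linarith) k
  simpa using this.sub_const κ

end IsRegulator

/-- Partial sums of nonnegative stage costs increase to the infinite-horizon cost, so overtaking
optimality implies optimality in `[0, ∞]`. -/
theorem IsOvertakingOptimal.infiniteCost_le {A : Matrix (Fin n) (Fin n) ℝ} (hQ : Q.PosSemidef)
    (hR : R.PosSemidef) {g : ℕ → Fin m → ℝ} (h : IsOvertakingOptimal A B Q R e x₀ g)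
    (v : ℕ → Fin m → ℝ) : infiniteCost A B Q R e x₀ g ≤ infiniteCost A B Q R e x₀ v := by
  have hsum : ∀ (u : ℕ → Fin m → ℝ) (N : ℕ),
      ∑ k ∈ Finset.range N, ENNReal.ofReal (stageCost Q R (state A B e x₀ u k) (u k)) =
        ENNReal.ofReal (finiteCost A B Q R e x₀ 0 N u) := by
    intro u N
    rw [← ENNReal.ofReal_sum_of_nonneg fun k _ => stageCost_nonneg hQ hR _ _, finiteCost]
    simp
  refine ENNReal.le_of_forall_pos_le_add fun ε hε _ => ?_
  refine le_of_tendsto ENNReal.summable.hasSum.tendsto_sum_nat ?_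
  filter_upwards [h v ε hε] with N hN
  rw [hsum]
  calc ENNReal.ofReal (finiteCost A B Q R e x₀ 0 N g)
      ≤ ENNReal.ofReal (finiteCost A B Q R e x₀ 0 N v + ε) := ENNReal.ofReal_le_ofReal hN
    _ ≤ ENNReal.ofReal (finiteCost A B Q R e x₀ 0 N v) + ENNReal.ofReal ε :=
        ENNReal.ofReal_add_le
    _ ≤ _ := by
        rw [ENNReal.ofReal_coe_nnreal, ← hsum]
        gcongr
        exact ENNReal.sum_le_tsum _

end Shift

end LQ

theorem mainTheorem2 {n m : ℕ} (Bg1 : Matrix (Fin n) (Fin m) ℝ)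
    (Q : Matrix (Fin n) (Fin n) ℝ) (R : Matrix (Fin m) (Fin m) ℝ)
    (hQ : Q.PosSemidef) (hR : R.PosDef) (hctrl : LQ.IsControllable 1 Bg1) :
    ∃ P : Matrix (Fin n) (Fin n) ℝ,
      (P.PosSemidef ∧ LQ.SolvesDARE 1 Bg1 Q R P) ∧
      (∀ P' : Matrix (Fin n) (Fin n) ℝ, P'.PosSemidef → LQ.SolvesDARE 1 Bg1 Q R P' → P' = P) ∧
      (LQ.IsStable (1 - Bg1 * LQ.fbGain 1 Bg1 R P) ↔ Q.PosDef) ∧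
      (IsUnit (1 - (1 - Bg1 * LQ.fbGain 1 Bg1 R P)ᵀ) ↔ Q.PosDef) ∧
      (Q.PosDef →
        ∀ (C : ℝ) (e1 x₀ : Fin n → ℝ), ∃ g : ℕ → Fin m → ℝ,
          (∀ k, g k = -(LQ.fbGain 1 Bg1 R P *ᵥ LQ.state 1 Bg1 (C • e1) x₀ g k)
            - LQ.ffGain 1 Bg1 R P *ᵥ (C • e1)) ∧
          (∀ v : ℕ → Fin m → ℝ,
            LQ.IsOvertakingOptimal 1 Bg1 Q R (C • e1) x₀ v ↔ v = g) ∧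
          (∀ v : ℕ → Fin m → ℝ,
            LQ.infiniteCost 1 Bg1 Q R (C • e1) x₀ g ≤ LQ.infiniteCost 1 Bg1 Q R (C • e1) x₀ v) ∧
          (∀ S : Matrix (Fin n) (Fin n) ℝ, S.PosSemidef →
            (∀ N : ℕ, ∃ v : ℕ → Fin m → ℝ,
              LQ.IsFiniteOptimal 1 Bg1 Q R (C • e1) x₀ S N v) ∧
            ∀ w : ℕ → ℕ → Fin m → ℝ,
              (∀ N : ℕ, LQ.IsFiniteOptimal 1 Bg1 Q R (C • e1) x₀ S N (w N)) →
              ∀ k : ℕ, Tendsto (fun N => w N k) atTop (𝓝 (g k)))) := by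
  obtain ⟨E, hE⟩ := hctrl.exists_mul_eq_one
  obtain ⟨P, hP, hs⟩ := LQ.exists_solvesDARE hE hR hQ
  refine ⟨P, ⟨hP, hs⟩, fun P' hP' hs' => hs.unique hE hR hQ hP hP' hs',
    hs.isStable_iff hR hP hQ, hs.isUnit_one_sub_iff hR hP hQ, fun hQ' C e1 x₀ => ?_⟩
  have h := hs.isRegulator hQ' hR hP
  have hM := (isUnit_iff_isUnit_det _).1 (LQ.posDef_mul_inv_mul_transpose hR hE).isUnit
  have hRu := (isUnit_iff_isUnit_det _).1 hR.isUnit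
  have hff := hs.ffGain_eq hE hR hP hQ'
  have hB : Bg1 *ᵥ (LQ.ffGain 1 Bg1 R P *ᵥ (C • e1)) = C • e1 := by
    rw [mulVec_mulVec, hff, ← Matrix.mul_assoc, ← Matrix.mul_assoc, mul_nonsing_inv _ hM,
      one_mulVec]
  have hl : R *ᵥ (LQ.ffGain 1 Bg1 R P *ᵥ (C • e1)) =
      Bg1ᵀ *ᵥ ((Bg1 * R⁻¹ * Bg1ᵀ)⁻¹ *ᵥ (C • e1)) := by
    rw [mulVec_mulVec, mulVec_mulVec, hff, ← Matrix.mul_assoc, ← Matrix.mul_assoc,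
      mul_nonsing_inv _ hRu, Matrix.one_mul]
  have ho := h.isOvertakingOptimal_iff (x₀ := x₀) hB hl
  refine ⟨_, fun k => ?_, ho, ((ho _).2 rfl).infiniteCost_le hQ hR.posSemidef, fun S hS =>
    ⟨LQ.exists_isFiniteOptimal hQ hR hS, fun w hw => h.tendsto_isFiniteOptimal hE hS hB hl hw⟩⟩
  simp only [LQ.state_eq_state_shift hB, sub_add_cancel, ← LQ.feedback_eq]
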